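/- Let $\ell\ge 1$ be an integer. For $m\ge 1$, an $(\ell,m)$-block is a quadruple $(G,r,S,T)$, where $G$ is a graph, $r\in V(G)$ and $S,T$ are disjoint $m$-element subsets of $V(G)\setminus\{r\}$, obtained (up to isomorphism) by the following recursive construction. (a) An $(\ell,1)$-block consists of a path of length $2\ell+1$ with ends $s,t$ together with a new isolated vertex $r$, where $S=\{s\}$ and $T=\{t\}$. (b) An $(\ell,m+1)$-block is obtained from an $(\ell,m)$-block $(H,r,S',T')$ as follows. Let $k\ge 2\ell$, let $J$ be the uniform binary tree with root $r_0$ and levels $0,\dots,k$, let $N=2^k$, and let $u_1,\dots,u_N$ be the leaves of $J$ from left to right. Let $n=2N$ and let $V_1,\dots,V_n$ be pairwise disjoint sets of $m$ new vertices each. For $1\le i<n$ let $(H_i,r_0,V_i,V_{i+1})$ be a copy of $(H,r,S',T')$, all vertices of $H_i$ outside $V_i\cup V_{i+1}\cup\{r_0\}$ being new; the identifications of $S'$ with $V_i$ and of $T'$ with $V_{i+1}$ are arbitrary bijections. Associate with each $i\in\{1,\dots,n\}$ one leaf of $J$: $u_1$ with $i=1$; $u_N$ with $i=n$; $u_j$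 with $i=2j-2$ for $2\le j\le N$; and $u_j$ with $i=2j+1$ for $1\le j<N$. Let $G$ be the union of $J,H_1,\dots,H_{n-1}$ together with, for each $i$ and each $v\in V_i$, a path of length $2\ell+1$, with new internal vertices, between $v$ and the leaf associated with $i$. Put $S=V_1\cup\{u_1\}$ and $T=V_n\cup\{u_N\}$. Then $(G,r_0,S,T)$ is an $(\ell,m+1)$-block. Theorem. Let $m\ge 0$, let $(G,r_0,S,T)$ be an $(\ell,m+1)$-block, and let $P,Q$ be paths of $G$, each with one end in $S$ and the other in $T$. Then either at least one of $P,Q$ contains $r_0$, or $\operatorname{dist}_G(P,Q)\le 2$, where $\operatorname{dist}_G(P,Q)$ is the least number of edges of a path of $G$ with one end in $V(P)$ and the other in $V(Q)$. -/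

import Mathlib

universe u

namespace CoarseMenger

/-- The distance between two sets of vertices of a graph: the least number of edges of a path
with one end in each (`⊤` if there is none). -/
noncomputable def setDist {V : Type u} (G : SimpleGraph V) (X Y : Set V) : ℕ∞ :=
  ⨅ x ∈ X, ⨅ y ∈ Y, G.edist x y

/-- Vertices of the uniform binary tree with levels `0, …, k`; level `i` has the `2 ^ i` vertices
at positions `0, …, 2 ^ i - 1`, numbered from left to right. Counting vertices on root-to-leaf
paths, this tree has depth `k + 1`. -/
@[ext]
structure TreeVertex (k : ℕ) where
  level : ℕ
  pos : ℕ
  level_le : level ≤ k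
  pos_lt : pos < 2 ^ level

/-- The root of the tree. -/
def TreeVertex.root (k : ℕ) : TreeVertex k := ⟨0, 0, Nat.zero_le k, by norm_num⟩

/-- The leaf of the tree at position `j`. -/
def TreeVertex.leaf (k : ℕ) (j : ℕ) (hj : j < 2 ^ k) : TreeVertex k := ⟨k, j, le_rfl, hj⟩

/-- `x` is the parent of `y`: the children of position `p` are at positions `2p` and `2p + 1`
of the next level. -/
def TreeVertex.IsParent {k : ℕ} (x y : TreeVertex k) : Prop :=
  y.level = x.level + 1 ∧ y.pos / 2 = x.pos

/-- The uniform binary tree of depth `k + 1`. -/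
def binaryTree (k : ℕ) : SimpleGraph (TreeVertex k) where
  Adj x y := x.IsParent y ∨ y.IsParent x
  symm := ⟨fun _ _ h => h.symm⟩
  loopless := ⟨fun x h => by
    rcases h with h | h <;> exact absurd h.1 (Nat.succ_ne_self _).symm⟩

/-- The number of intervals between consecutive anchors. There is one anchor more than that,
hence `2 ^ (k + 1)` anchors. -/
def numGaps (k : ℕ) : ℕ := 2 ^ (k + 1) - 1

/-- The position of the leaf of the tree to which the anchor number `b` is joined, where the
anchors are numbered `0, …, 2 ^ (k + 1) - 1`. The first anchor goes to the first leaf, the last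
one to the last leaf, and otherwise an odd `b = 2j - 1` goes to leaf `j` and an even `b = 2j + 2`
goes to leaf `j`. So every leaf receives two anchors; together with these, the tree becomes a
(subdivided) uniform binary tree of depth `k + 2` whose leaves are the anchors. -/
def attachPos (k b : ℕ) : ℕ :=
  if b = 0 then 0
  else if b = numGaps k then 2 ^ k - 1
  else if b % 2 = 1 then (b + 1) / 2
  else b / 2 - 1

theorem attachPos_lt (k : ℕ) (b : Fin (numGaps k + 1)) : attachPos k b < 2 ^ k := by
  have hb := b.isLt
  have h1 : 0 < 2 ^ k := by positivity
  have h2 : 2 ^ (k + 1) = 2 * 2 ^ k := by ring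
  unfold attachPos
  unfold numGaps at *
  split_ifs <;> omega

/-- The leaf of the tree to which an anchor is joined. -/
def attachLeaf (k : ℕ) (b : Fin (numGaps k + 1)) : TreeVertex k :=
  TreeVertex.leaf k (attachPos k b) (attachPos_lt k b)

/-- The first leaf of the tree. -/
def firstLeaf (k : ℕ) : TreeVertex k := TreeVertex.leaf k 0 (by positivity)

/-- The last leaf of the tree. -/
def lastLeaf (k : ℕ) : TreeVertex k :=
  TreeVertex.leaf k (2 ^ k - 1) (Nat.sub_lt (by positivity) one_pos)

section Glue

variable (ℓ m k : ℕ) {W : Type u} (H : SimpleGraph W) (r : W) (S T : Set W)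

/-- The vertices of the graph assembled from the binary tree of depth `k + 1` and one copy of
`(H, r, S, T)`, with `S` and `T` of size `m`, for each pair of consecutive anchors:
the vertices of the tree (its root also being the root of all the copies), the vertices of the
sets `V_i` replacing the anchors, the remaining vertices of the copies, and the `2ℓ` internal
vertices of the spines (one spine for each vertex of each `V_i`). -/
inductive GlueVertex : Type u
  | tree (x : TreeVertex k)
  | anchor (i : Fin (numGaps k + 1)) (a : Fin m)
  | inner (i : Fin (numGaps k)) (x : W) (hr : x ≠ r) (hS : x ∉ S) (hT : x ∉ T)
  | spine (i : Fin (numGaps k + 1)) (a : Fin m) (q : Fin (2 * ℓ))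

variable {r S T}

open Classical in
/-- The `i`-th copy of `H`: its root is the root of the tree, its set `S` is identified with `V_i`
through the bijection `σ`, and its set `T` with `V_{i+1}` through the bijection `τ`. -/
noncomputable def copyVertex (i : Fin (numGaps k)) (σ : S ≃ Fin m) (τ : T ≃ Fin m) (x : W) :
    GlueVertex ℓ m k r S T :=
  if hr : x = r then .tree (TreeVertex.root k)
  else if hS : x ∈ S then .anchor i.castSucc (σ ⟨x, hS⟩)
  else if hT : x ∈ T then .anchor i.succ (τ ⟨x, hT⟩)
  else .inner i x hr hS hT

variable (r S T) in
/-- The `q`-th vertex of the spine from the vertex `a` of `V_i` to the leaf of the tree that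
the `i`-th anchor is joined to: a path of length `2ℓ + 1`. -/
def spineVertex (i : Fin (numGaps k + 1)) (a : Fin m) (q : Fin (2 * ℓ + 2)) :
    GlueVertex ℓ m k r S T :=
  if h0 : q.val = 0 then .tree (attachLeaf k i)
  else if h1 : q.val = 2 * ℓ + 1 then .anchor i a
  else .spine i a ⟨q.val - 1, by have := q.isLt; omega⟩

/-- The union of the tree, the copies of `H` and the spines. -/
noncomputable def glueGraph (σ : Fin (numGaps k) → (S ≃ Fin m)) (τ : Fin (numGaps k) → (T ≃ Fin m)) :
    SimpleGraph (GlueVertex ℓ m k r S T) :=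
  (binaryTree k).map GlueVertex.tree
    ⊔ (⨆ i, H.map (copyVertex ℓ m k i (σ i) (τ i)))
    ⊔ ⨆ (i) (a), (SimpleGraph.pathGraph (2 * ℓ + 2)).map (spineVertex ℓ m k r S T i a)

variable (r S T)

/-- The new set `S`: the first of the sets `V_i`, and the first leaf of the tree. -/
def glueS : Set (GlueVertex ℓ m k r S T) :=
  insert (.tree (firstLeaf k)) (Set.range (GlueVertex.anchor 0))

/-- The new set `T`: the last of the sets `V_i`, and the last leaf of the tree. -/
def glueT : Set (GlueVertex ℓ m k r S T) :=
  insert (.tree (lastLeaf k)) (Set.range (GlueVertex.anchor (Fin.last (numGaps k))))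

end Glue

/-- `IsBlock ℓ m G r S T` says that `(G, r, S, T)` is an `(ℓ, m)`-block.

* An `(ℓ, 1)`-block is a path of length `2ℓ + 1` with ends `s, t` together with an isolated
  vertex `r`, where `S = {s}` and `T = {t}`.
* An `(ℓ, m + 1)`-block is assembled from a binary tree of depth `k + 1 ≥ 2ℓ + 1` and copies of an
  `(ℓ, m)`-block `(H, r', S', T')`, all sharing the root of the tree as their root, the terminals
  of consecutive copies being identified by arbitrary bijections.

For `m = 1` the copies of `H` in the second clause are the dotted paths between consecutive
anchors, so that clause gives exactly the usual `(ℓ, 2)`-blocks (whose binary tree, with the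
anchors as its leaves, has depth `k + 2 ≥ 2ℓ + 2`). Isomorphic copies are allowed throughout. -/
inductive IsBlock (ℓ : ℕ) : ℕ → {V : Type u} → SimpleGraph V → V → Set V → Set V → Prop
  | one {V : Type u} {G : SimpleGraph V} {r : V} {S T : Set V}
      (e : (SimpleGraph.pathGraph (2 * ℓ + 2)).map (some : _ → Option (Fin (2 * ℓ + 2))) ≃g G)
      (hr : e none = r) (hS : S = {e (some 0)}) (hT : T = {e (some (Fin.last (2 * ℓ + 1)))}) :
      IsBlock ℓ 1 G r S T
  | step {m k : ℕ} (hk : 2 * ℓ ≤ k)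
      {W : Type u} {H : SimpleGraph W} {r' : W} {S' T' : Set W} (hH : IsBlock ℓ m H r' S' T')
      (σ : Fin (numGaps k) → (S' ≃ Fin m)) (τ : Fin (numGaps k) → (T' ≃ Fin m))
      {V : Type u} {G : SimpleGraph V} {r : V} {S T : Set V}
      (e : glueGraph (r := r') ℓ m k H σ τ ≃g G)
      (hr : e (.tree (TreeVertex.root k)) = r)
      (hS : S = e '' glueS ℓ m k r' S' T') (hT : T = e '' glueT ℓ m k r' S' T') :
      IsBlock ℓ (m + 1) G r S T

end CoarseMenger

/-! By induction on blocks, any two walks from `S` to `T` avoiding the root come within distance 2.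
For an `(ℓ, 1)`-block both start at the same vertex.

In a glued block, suppose two such walks are further apart. Contract each `V_i` to a point and each
spine to an edge; each walk becomes a mod-2 chain from the left end to the right end of the
quotient. By induction no copy of `H` is crossed from side to side by both, so the chains share no
line edge. Nor do their walks share a tree vertex or contain two siblings, since siblings are at
distance 2.

The contradiction is a parity argument. Between leaves `b - 1` and `b` the line is cut by three
edges, because consecutive leaves have interleaved anchors. If both chains cross there oddly, each
uses one outer edge, and one walk contains leaf `b` while the other contains leaf `b - 1`
(`owners_of_bothCross`). Going up the tree, each walk also contains the ancestors having that
boundary as an end of their leaf interval (`mem_of_bothCross`). As the root is avoided, both chains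
cross the middle boundary oddly, so the two children of the root lie on different walks (`not_far`).
-/

namespace CoarseMenger

/-! ### Cuts modulo 2 in the quotient. -/

/-- An edge of the quotient of a block in which every set of anchors and every spine is contracted
to a point: an edge of the line of anchors, an edge joining an anchor to its leaf, or the edge
joining the tree vertex at level `d + 1` and position `p` to its parent. -/
inductive QuotientEdge
  | line (i : ℕ)
  | spine (b : ℕ)
  | top (d p : ℕ)
  deriving DecidableEq

/-- The coboundary modulo 2 of a function on the vertices of the quotient; a tree vertex is given
by its level and position. -/
def coboundary (k : ℕ) (f : ℕ × ℕ ⊕ ℕ → ZMod 2) : QuotientEdge → ZMod 2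
  | .line i => f (.inr i) + f (.inr (i + 1))
  | .spine b => f (.inr b) + f (.inl (k, attachPos k b))
  | .top d p => f (.inl (d + 1, p)) + f (.inl (d, p / 2))

/-- The edges of the quotient that use only tree vertices in `A` and line edges in `X`. -/
def Supports (k : ℕ) (A : ℕ → ℕ → Prop) (X : ℕ → Prop) : QuotientEdge → Prop
  | .line i => i < numGaps k ∧ X i
  | .spine b => A k (attachPos k b)
  | .top d p => d + 1 ≤ k ∧ A (d + 1) p ∧ A d (p / 2)

/-- Double counting: when the coboundary of `f` is the indicator of the cut `C` on the edges of `L`,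
summing it over `L` counts how often `L` meets `C`. -/
theorem sum_coboundary_eq_sum_count {k : ℕ} {f : ℕ × ℕ ⊕ ℕ → ZMod 2} {L C : List QuotientEdge}
    (h : ∀ e ∈ L, coboundary k f e = (C.map fun c => if c = e then (1 : ZMod 2) else 0).sum) :
    (L.map (coboundary k f)).sum = (C.map fun c => (L.count c : ZMod 2)).sum := by
  induction L with
  | nil => simp
  | cons e L ih =>
    rw [List.map_cons, List.sum_cons, ih fun e' he' => h e' (List.mem_cons_of_mem _ he'),
      h e List.mem_cons_self, ← List.sum_map_add]
    congr 1
    refine List.map_congr_left fun c _ => ?_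
    rw [List.count_cons]
    by_cases hc : c = e
    · simp [hc, add_comm]
    · simp [hc, Ne.symm hc]

/-- The anchors joined to leaves before `c` are `0, …, 2c - 2` and `2c`. The gap at `2c - 1` makes
three line edges change sides. -/
theorem attachPos_lt_coboundary {k i c : ℕ} (hi : i < numGaps k) (hc : 0 < c) (hc' : c < 2 ^ k) :
    (if attachPos k i < c then (1 : ZMod 2) else 0) + (if attachPos k (i + 1) < c then 1 else 0) =
      (if 2 * c - 2 = i then 1 else 0) + (if 2 * c - 1 = i then 1 else 0) +
        (if 2 * c = i then 1 else 0) := by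
  have h2 : 2 ^ (k + 1) = 2 * 2 ^ k := by ring
  unfold numGaps at hi
  have h : ∀ j ≤ numGaps k, (attachPos k j < c ↔ j ≤ 2 * c - 2 ∨ j = 2 * c) := by
    unfold attachPos numGaps
    intro j hj
    split_ifs <;> omega
  have h1 := h i (by unfold numGaps; omega)
  have h3 := h (i + 1) (by unfold numGaps; omega)
  clear h
  simp only [h1, h3]
  have : (1 : ZMod 2) + 1 = 0 := by decide
  split_ifs <;> first | omega | simp [this]

/-- The line edges at the boundary between the leaves `c - 1` and `c`, if there are such leaves. -/
def lineCut (k c : ℕ) : List QuotientEdge :=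
  if c = 0 ∨ c = 2 ^ k then [] else [.line (2 * c - 2), .line (2 * c - 1), .line (2 * c)]

theorem attachPos_lt_coboundary_eq_sum_lineCut {k i c : ℕ} (hi : i < numGaps k) (hc : c ≤ 2 ^ k) :
    (if attachPos k i < c then (1 : ZMod 2) else 0) + (if attachPos k (i + 1) < c then 1 else 0) =
      ((lineCut k c).map fun e => if e = .line i then (1 : ZMod 2) else 0).sum := by
  by_cases h0 : c = 0 ∨ c = 2 ^ k
  · rw [lineCut, if_pos h0]
    rcases h0 with rfl | rfl
    · simp
    · rw [if_pos (attachPos_lt k ⟨i, by omega⟩), if_pos (attachPos_lt k ⟨i + 1, by omega⟩)]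
      exact CharTwo.add_self_eq_zero 1
  · rw [lineCut, if_neg h0, attachPos_lt_coboundary hi (by omega) (by omega)]
    simp [add_assoc]

theorem sum_lineCut_eq_zero {k c : ℕ} {e : QuotientEdge} (he : ∀ i, e ≠ .line i) :
    ((lineCut k c).map fun e' => if e' = e then (1 : ZMod 2) else 0).sum = 0 := by
  unfold lineCut
  split_ifs <;> simp [fun i => (he i).symm]

/-! ### The parity argument: two far flows cannot coexist. -/

/-- Two families of edges of the quotient, with mod-2 boundary one vertex on the left and one vertex
on the right, that use disjoint sets of line edges and sets of tree vertices that avoid the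
root, are disjoint and contain no two siblings. -/
structure FarFlows (k : ℕ) where
  A : Bool → ℕ → ℕ → Prop
  X : Bool → ℕ → Prop
  L : Bool → List QuotientEdge
  supports : ∀ β, ∀ e ∈ L β, Supports k (A β) (X β) e
  flow : ∀ β, ∃ s t : ℕ × ℕ ⊕ ℕ, (s = .inr 0 ∨ s = .inl (k, 0)) ∧
    (t = .inr (numGaps k) ∨ t = .inl (k, 2 ^ k - 1)) ∧
    ∀ f, f s + f t = ((L β).map (coboundary k f)).sum
  line_disjoint : ∀ β i, X β i → ¬ X (!β) i
  tree_disjoint : ∀ β d p, A β d p → ¬ A (!β) d p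
  siblings : ∀ β d p, A β (d + 1) (2 * p) → ¬ A (!β) (d + 1) (2 * p + 1)
  root : ∀ β, ¬ A β 0 0

namespace FarFlows

variable {k : ℕ} (F : FarFlows k)

/-- The number of times modulo 2 that an edge of the quotient is used. -/
def num (β : Bool) (e : QuotientEdge) : ZMod 2 := ((F.L β).count e : ZMod 2)

/-- The number of times modulo 2 that the line is traversed at the boundary between the leaves
`b - 1` and `b`. -/
def tri (β : Bool) (b : ℕ) : ZMod 2 :=
  F.num β (.line (2 * b - 2)) + F.num β (.line (2 * b - 1)) + F.num β (.line (2 * b))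

/-- Both families traverse the line at the boundary between the leaves `b - 1` and `b`. -/
def BothCross (b : ℕ) : Prop := 0 < b ∧ b < 2 ^ k ∧ ∀ β, F.tri β b = 1

variable {F}

theorem supports_of_num_ne_zero {β : Bool} {e : QuotientEdge} (h : F.num β e ≠ 0) :
    Supports k (F.A β) (F.X β) e := by
  refine F.supports β e (by_contra fun he => h ?_)
  simp [num, List.count_eq_zero_of_not_mem he]

theorem num_line_disjoint (β : Bool) (i : ℕ) :
    F.num β (.line i) = 0 ∨ F.num (!β) (.line i) = 0 := by
  by_contra! h
  exact F.line_disjoint β i (supports_of_num_ne_zero h.1).2 (supports_of_num_ne_zero h.2).2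

/-- Conservation at an interior anchor, by testing the flow against its indicator. -/
theorem num_anchor (β : Bool) {v : ℕ} (hv : 0 < v) (hv' : v < numGaps k) :
    F.num β (.line (v - 1)) + F.num β (.line v) + F.num β (.spine v) = 0 := by
  obtain ⟨s, t, hs, ht, h⟩ := F.flow β
  have h := h fun x => if x = .inr v then 1 else 0
  rw [sum_coboundary_eq_sum_count (C := [.line (v - 1), .line v, .spine v])] at h
  · simp only [List.map_cons, List.map_nil, List.sum_cons, List.sum_nil] at h
    have h1 : s ≠ .inr v := by rcases hs with rfl | rfl <;> simp; omega
    have h2 : t ≠ .inr v := by rcases ht with rfl | rfl <;> simp; omega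
    simp only [num]
    simp only [h1, h2, if_false] at h
    rw [← add_zero (0 : ZMod 2), h]; ring
  · rintro (i | b | ⟨d, p⟩) -
    · by_cases h1 : i = v
      · subst h1; simp [coboundary]; omega
      · by_cases h2 : i + 1 = v
        · subst h2; simp [coboundary]
        · have h3 : v - 1 ≠ i := by omega
          simp [coboundary, h1, h2, h3, Ne.symm h1]
    · simp [coboundary, eq_comm]
    · simp [coboundary]

/-- Disjointness leaves each family exactly one of the three edges modulo 2. Using the middle one
would force spines to both leaves `b` and `b - 1`, one of which the other family also needs. So the
families use the two outer edges, and conservation forces the spine from `2b - 1` to leaf `b` for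
one and from `2b` to leaf `b - 1` for the other. -/
theorem owners_of_bothCross {b : ℕ} (h : F.BothCross b) :
    ∃ β, F.A β k b ∧ F.A (!β) k (b - 1) := by
  obtain ⟨h0, h1, h⟩ := h
  have h2 : 2 ^ (k + 1) = 2 * 2 ^ k := by ring
  have e1 : attachPos k (2 * b - 1) = b := by unfold attachPos numGaps; split_ifs <;> omega
  have e2 : attachPos k (2 * b) = b - 1 := by unfold attachPos numGaps; split_ifs <;> omega
  have hs1 : ∀ β, F.num β (.spine (2 * b - 1)) ≠ 0 → F.A β k b := fun β hβ => by
    have := supports_of_num_ne_zero hβ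
    simpa [Supports, e1] using this
  have hs2 : ∀ β, F.num β (.spine (2 * b)) ≠ 0 → F.A β k (b - 1) := fun β hβ => by
    have := supports_of_num_ne_zero hβ
    simpa [Supports, e2] using this
  have ha1 : ∀ β, F.num β (.line (2 * b - 2)) + F.num β (.line (2 * b - 1)) +
      F.num β (.spine (2 * b - 1)) = 0 := fun β =>
    num_anchor (F := F) β (v := 2 * b - 1) (by omega) (by unfold numGaps; omega)
  have ha2 : ∀ β, F.num β (.line (2 * b - 1)) + F.num β (.line (2 * b)) +
      F.num β (.spine (2 * b)) = 0 := fun β =>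
    num_anchor (F := F) β (v := 2 * b) (by omega) (by unfold numGaps; omega)
  have d1 := F.tree_disjoint true k b
  have d2 := F.tree_disjoint true k (b - 1)
  have t1 := h true
  have t2 := h false
  have l1 := num_line_disjoint (F := F) true (2 * b - 2)
  have l2 := num_line_disjoint (F := F) true (2 * b - 1)
  have l3 := num_line_disjoint (F := F) true (2 * b)
  have a1 := ha1 true
  have a2 := ha1 false
  have a3 := ha2 true
  have a4 := ha2 false
  have b1 := hs1 true
  have b2 := hs1 false
  have b3 := hs2 true
  have b4 := hs2 false
  have goal : (F.A true k b ∧ F.A false k (b - 1)) ∨ (F.A false k b ∧ F.A true k (b - 1)) := by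
    simp only [tri, Bool.not_true] at *
    -- The last two alternatives are the middle-edge cases, excluded afterwards by disjointness at a
    -- leaf.
    have key : ∀ x y z u v x' y' z' u' v' : ZMod 2, x + y + z = 1 → x' + y' + z' = 1 →
        (x = 0 ∨ x' = 0) → (y = 0 ∨ y' = 0) → (z = 0 ∨ z' = 0) → x + y + u = 0 → y + z + v = 0 →
        x' + y' + u' = 0 → y' + z' + v' = 0 →
        (u ≠ 0 ∧ v' ≠ 0) ∨ (u' ≠ 0 ∧ v ≠ 0) ∨ (u ≠ 0 ∧ u' ≠ 0) ∨ (v ≠ 0 ∧ v' ≠ 0) := by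
      have two : ∀ x : ZMod 2, x = 0 ∨ x = 1 := by decide
      intro x y z u v x' y' z' u' v' h1 h2 h3 h4 h5 h6 h7 h8 h9
      have eu : u = x + y := by
        rw [← add_zero u, ← CharTwo.add_self_eq_zero (x + y), ← add_assoc, add_comm u, h6, zero_add]
      have ev : v = y + z := by
        rw [← add_zero v, ← CharTwo.add_self_eq_zero (y + z), ← add_assoc, add_comm v, h7, zero_add]
      have eu' : u' = x' + y' := by
        rw [← add_zero u', ← CharTwo.add_self_eq_zero (x' + y'), ← add_assoc, add_comm u', h8,
          zero_add]
      have ev' : v' = y' + z' := by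
        rw [← add_zero v', ← CharTwo.add_self_eq_zero (y' + z'), ← add_assoc, add_comm v', h9,
          zero_add]
      subst eu ev eu' ev'
      clear h6 h7 h8 h9
      revert x y z x' y' z'
      decide
    rcases key _ _ _ _ _ _ _ _ _ _ t1 t2 l1 l2 l3 a1 a3 a2 a4 with h | h | h | h
    · exact .inl ⟨b1 h.1, b4 h.2⟩
    · exact .inr ⟨b2 h.1, b3 h.2⟩
    · exact absurd (b2 h.2) (d1 (b1 h.1))
    · exact absurd (b4 h.2) (d2 (b3 h.1))
  rcases goal with h | h
  · exact ⟨true, h⟩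
  · exact ⟨false, h⟩

/-- The parity of the number of edges leaving the part of the quotient that consists of the
descendants of a tree vertex and of the anchors joined to them. -/
theorem num_top_add_tri (β : Bool) {d p : ℕ} (hd : d + 1 ≤ k) (hp : p < 2 ^ (d + 1)) :
    F.num β (.top d p) + (if p = 0 then 1 else F.tri β (p * 2 ^ (k - (d + 1)))) +
      (if p + 1 = 2 ^ (d + 1) then 1 else F.tri β ((p + 1) * 2 ^ (k - (d + 1)))) = 0 := by
  have hN : 2 ^ (d + 1) * 2 ^ (k - (d + 1)) = 2 ^ k := by rw [← pow_add]; congr 1; omega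
  have hD : 0 < 2 ^ (k - (d + 1)) := by positivity
  have hc : 0 < (p + 1) * 2 ^ (k - (d + 1)) := by positivity
  have ha' : p * 2 ^ (k - (d + 1)) < 2 ^ k := by
    rw [← hN]; exact Nat.mul_lt_mul_of_pos_right hp hD
  have hac : p * 2 ^ (k - (d + 1)) < (p + 1) * 2 ^ (k - (d + 1)) :=
    Nat.mul_lt_mul_of_pos_right p.lt_succ_self hD
  have ha : p = 0 ↔ p * 2 ^ (k - (d + 1)) = 0 := by simp
  have hcN : p + 1 = 2 ^ (d + 1) ↔ (p + 1) * 2 ^ (k - (d + 1)) = 2 ^ k := by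
    rw [← hN, Nat.mul_left_inj hD.ne']
  have hc' : (p + 1) * 2 ^ (k - (d + 1)) ≤ 2 ^ k := by
    rw [← hN]; exact Nat.mul_le_mul_right _ hp
  have hdiv : ∀ j, j / 2 ^ (k - (d + 1)) = p ↔
      p * 2 ^ (k - (d + 1)) ≤ j ∧ j < (p + 1) * 2 ^ (k - (d + 1)) := fun j =>
    (Nat.div_eq_iff hD).trans <| by rw [Nat.succ_mul]; omega
  simp only [ha, hcN]
  generalize p * 2 ^ (k - (d + 1)) = a at *
  generalize (p + 1) * 2 ^ (k - (d + 1)) = c at *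
  -- The descendants of the vertex at level `d + 1` and position `p`; their leaves are those in `[a,
  -- c)`.
  let D : ℕ → ℕ → Prop := fun d' p' => d + 1 ≤ d' ∧ p' / 2 ^ (d' - (d + 1)) = p
  have hDleaf : ∀ j, D k j ↔ a ≤ j ∧ j < c := fun j => by simp only [D, hdiv, hd, true_and]
  classical
  let f : ℕ × ℕ ⊕ ℕ → ZMod 2 := Sum.elim (fun x => if D x.1 x.2 then 1 else 0)
    (fun b => if D k (attachPos k b) then 1 else 0)
  obtain ⟨s, t, hs, ht, hflow⟩ := F.flow β
  have h := hflow f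
  -- Anchor `0` is joined to leaf `0`, so both possible sources lie on the same side of the cut;
  -- likewise for the targets.
  have hfs : f s = if a = 0 then 1 else 0 := by
    have e0 : attachPos k 0 = 0 := by simp [attachPos]
    have : f s = if D k 0 then 1 else 0 := by rcases hs with rfl | rfl <;> simp [f, e0]
    simp [this, hDleaf, hc]
  have hft : f t = if c = 2 ^ k then 1 else 0 := by
    have e0 : attachPos k (numGaps k) = 2 ^ k - 1 := by
      have : numGaps k ≠ 0 := by
        have : 2 ^ (k + 1) = 2 * 2 ^ k := by ring
        unfold numGaps; omega
      simp [attachPos, this]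
    have : f t = if D k (2 ^ k - 1) then 1 else 0 := by rcases ht with rfl | rfl <;> simp [f, e0]
    rw [this]
    exact if_congr ((hDleaf _).trans (by omega)) rfl rfl
  rw [hfs, hft, sum_coboundary_eq_sum_count (C := .top d p :: (lineCut k a ++ lineCut k c))] at h
  · have key : ∀ c, ((lineCut k c).map fun e => ((F.L β).count e : ZMod 2)).sum =
        if c = 0 ∨ c = 2 ^ k then 0 else F.tri β c := by
      intro c
      unfold lineCut
      split_ifs <;> simp [tri, num, add_assoc]
    rw [List.map_cons, List.sum_cons, List.map_append, List.sum_append, key, key] at h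
    have h1 : ¬ (a = 0 ∧ c = 2 ^ k) := by
      rintro ⟨h1, h2⟩
      rw [← ha] at h1
      rw [← hcN, h1, pow_succ] at h2
      omega
    have e1 : (a = 0 ∨ a = 2 ^ k) ↔ a = 0 := by omega
    have e2 : (c = 0 ∨ c = 2 ^ k) ↔ c = 2 ^ k := by omega
    simp only [e1, e2] at h
    change _ = F.num β (.top d p) + _ at h
    have fin : ∀ x y z : ZMod 2, (1 + 0 = x + (0 + z) → x + 1 + z = 0) ∧
        (0 + 1 = x + (y + 0) → x + y + 1 = 0) ∧ (0 + 0 = x + (y + z) → x + y + z = 0) := by decide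
    split_ifs at h ⊢ with h3 h4 h4
    · exact absurd ⟨h3, h4⟩ h1
    · exact (fin _ 0 _).1 h
    · exact (fin _ _ 0).2.1 h
    · exact (fin _ _ _).2.2 h
  · intro e he
    have hsup := F.supports β e he
    rw [List.map_cons, List.sum_cons, List.map_append, List.sum_append]
    rcases e with i | b | ⟨d', p'⟩
    · rw [← attachPos_lt_coboundary_eq_sum_lineCut hsup.1 ha'.le,
        ← attachPos_lt_coboundary_eq_sum_lineCut hsup.1 hc']
      -- Modulo 2, the interval `[a, c)` is the sum of two initial segments.
      have split : ∀ j, (if D k j then (1 : ZMod 2) else 0) =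
          (if j < a then 1 else 0) + (if j < c then 1 else 0) := by
        intro j
        have two : (1 : ZMod 2) + 1 = 0 := by decide
        simp only [hDleaf]
        split_ifs <;> first | omega | simp [two]
      simp only [coboundary, f, Sum.elim_inr, split, reduceCtorEq, if_false]
      ring
    · rw [sum_lineCut_eq_zero (by simp), sum_lineCut_eq_zero (by simp)]
      simp only [coboundary, f, Sum.elim_inr, Sum.elim_inl, reduceCtorEq, if_false]
      rw [CharTwo.add_self_eq_zero]
      simp
    · rw [sum_lineCut_eq_zero (by simp), sum_lineCut_eq_zero (by simp)]
      have hD1 : D (d' + 1) p' ↔ (d = d' ∧ p = p') ∨ D d' (p' / 2) := by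
        simp only [D]
        rcases lt_trichotomy d d' with h | rfl | h
        · have e1 : d' + 1 - (d + 1) = d' - (d + 1) + 1 := by omega
          rw [e1, pow_succ', Nat.div_div_eq_div_mul]
          omega
        · simp [eq_comm]
        · omega
      have hD2 : ¬ ((d = d' ∧ p = p') ∧ D d' (p' / 2)) := by
        simp only [D]; omega
      simp only [coboundary, f, Sum.elim_inl, QuotientEdge.top.injEq, hD1]
      have two : (1 : ZMod 2) + 1 = 0 := by decide
      by_cases h3 : d = d' ∧ p = p' <;> by_cases h4 : D d' (p' / 2) <;>
        simp_all

/-- Induction from the leaves upwards. A family holding a child but not its parent would leave the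
edge between them unused by both families, so the double crossing would pass to the boundary between
the two children; there it would put these siblings in different families. -/
theorem mem_of_bothCross {d : ℕ} (hd0 : 0 < d) (hd : d ≤ k) : ∀ p < 2 ^ d, ∀ β,
    (F.BothCross (p * 2 ^ (k - d)) → F.A β k (p * 2 ^ (k - d)) → F.A β d p) ∧
    (F.BothCross ((p + 1) * 2 ^ (k - d)) → F.A β k ((p + 1) * 2 ^ (k - d) - 1) → F.A β d p) := by
  induction hd using Nat.decreasingInduction with
  | self => simp
  | of_succ d hd ih =>
    intro p hp β
    have ih := ih d.succ_pos
    have hpow : 2 ^ (k - d) = 2 * 2 ^ (k - (d + 1)) := by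
      rw [← pow_succ']; congr 1; omega
    have hpow' : 2 ^ (d + 1) = 2 * 2 ^ d := by ring
    have ea : p * 2 ^ (k - d) = 2 * p * 2 ^ (k - (d + 1)) := by rw [hpow]; ring
    have ec : (p + 1) * 2 ^ (k - d) = (2 * p + 1 + 1) * 2 ^ (k - (d + 1)) := by rw [hpow]; ring
    have hmid : ¬ F.BothCross ((2 * p + 1) * 2 ^ (k - (d + 1))) := fun hb => by
      obtain ⟨γ, h1, h2⟩ := owners_of_bothCross hb
      exact F.siblings (!γ) d p ((ih (2 * p) (by omega) (!γ)).2 hb h2)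
        (by simpa using (ih (2 * p + 1) (by omega) γ).1 hb h1)
    have hpos : 0 < (2 * p + 1) * 2 ^ (k - (d + 1)) := by positivity
    have hlt : (2 * p + 1) * 2 ^ (k - (d + 1)) < 2 ^ k := by
      calc _ < (2 ^ (d + 1)) * 2 ^ (k - (d + 1)) := by
            refine Nat.mul_lt_mul_of_pos_right (by omega) (by positivity)
        _ = 2 ^ k := by rw [← pow_add]; congr 1; omega
    have two : ∀ x : ZMod 2, 0 + 1 + x = 0 → x = 1 := by decide
    have two' : ∀ x : ZMod 2, 0 + x + 1 = 0 → x = 1 := by decide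
    constructor
    · intro ha hA
      rw [ea] at ha hA
      have hy := (ih (2 * p) (by omega) β).1 ha hA
      by_contra hx
      refine hmid ⟨hpos, hlt, fun γ => ?_⟩
      -- One family misses the parent, the other misses the child.
      have h0 : F.num γ (.top d (2 * p)) = 0 := by
        by_contra hne
        have h1 := supports_of_num_ne_zero hne
        simp only [Supports, Nat.mul_div_cancel_left p two_pos] at h1
        rcases Bool.eq_or_eq_not γ β with rfl | rfl
        · exact hx h1.2.2
        · exact F.tree_disjoint _ _ _ hy h1.2.1
      have hp0 : 2 * p ≠ 0 := by rintro h; simp [h] at ha; exact absurd ha.1 (lt_irrefl 0)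
      have := num_top_add_tri (F := F) γ hd (show 2 * p < 2 ^ (d + 1) by omega)
      rw [h0, if_neg hp0, if_neg (by omega), ha.2.2 γ] at this
      exact two _ this
    · intro hc hA
      rw [ec] at hc hA
      have hz := (ih (2 * p + 1) (by omega) β).2 hc hA
      by_contra hx
      refine hmid ⟨hpos, hlt, fun γ => ?_⟩
      have h0 : F.num γ (.top d (2 * p + 1)) = 0 := by
        by_contra hne
        have h1 := supports_of_num_ne_zero hne
        have hdiv : (2 * p + 1) / 2 = p := by omega
        simp only [Supports, hdiv] at h1
        rcases Bool.eq_or_eq_not γ β with rfl | rfl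
        · exact hx h1.2.2
        · exact F.tree_disjoint _ _ _ hz h1.2.1
      have hp1 : 2 * p + 1 + 1 ≠ 2 ^ (d + 1) := by
        intro h
        have := hc.2.1
        rw [h, ← pow_add] at this
        simp [Nat.add_sub_cancel' (show d + 1 ≤ k from hd)] at this
      have := num_top_add_tri (F := F) γ hd (show 2 * p + 1 < 2 ^ (d + 1) by omega)
      rw [h0, if_neg (by omega), if_neg hp1, hc.2.2 γ] at this
      exact two' _ this

theorem not_far (F : FarFlows k) (hk : 1 ≤ k) : False := by
  have hc : F.BothCross (1 * 2 ^ (k - 1)) := by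
    refine ⟨by positivity, ?_, fun β => ?_⟩
    · rw [one_mul]; exact Nat.pow_lt_pow_right one_lt_two (by omega)
    · have h0 : F.num β (.top 0 0) = 0 := by
        by_contra hne
        exact F.root β (supports_of_num_ne_zero hne).2.2
      have := num_top_add_tri (F := F) β (d := 0) (p := 0) hk (by norm_num)
      rw [h0] at this
      simp only [if_true, zero_add] at this
      rw [if_neg (by norm_num)] at this
      have two : ∀ x : ZMod 2, 1 + x = 0 → x = 1 := by decide
      exact two _ this
  obtain ⟨γ, h1, h2⟩ := owners_of_bothCross hc
  have hz := (mem_of_bothCross (F := F) one_pos hk 1 (by norm_num) γ).1 hc h1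
  have hy := (mem_of_bothCross (F := F) one_pos hk 0 (by norm_num) (!γ)).2 (by simpa using hc)
    (by simpa using h2)
  exact F.siblings (!γ) 0 0 (by simpa using hy) (by simpa using hz)

end FarFlows

/-! ### Closeness of walks, and its transfer along maps. -/

/-- Any two walks from `S` to `T` that avoid `r` contain vertices at distance at most two. -/
def WalksClose {V : Type u} (G : SimpleGraph V) (r : V) (S T : Set V) : Prop :=
  ∀ ⦃s t s' t' : V⦄, s ∈ S → t ∈ T → s' ∈ S → t' ∈ T → ∀ (P : G.Walk s t) (Q : G.Walk s' t'),
    r ∉ P.support → r ∉ Q.support → ∃ u ∈ P.support, ∃ v ∈ Q.support, G.edist u v ≤ 2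

theorem WalksClose.of_iso {V V' : Type u} {G : SimpleGraph V} {G' : SimpleGraph V'} {r : V}
    {S T : Set V} (h : WalksClose G r S T) (e : G ≃g G') :
    WalksClose G' (e r) (e '' S) (e '' T) := by
  rintro _ _ _ _ ⟨s, hs, rfl⟩ ⟨t, ht, rfl⟩ ⟨s', hs', rfl⟩ ⟨t', ht', rfl⟩ P Q hP hQ
  have key : ∀ {x y : V} (P : G'.Walk (e x) (e y)), ∃ P' : G.Walk x y,
      ∀ z, z ∈ P'.support → e z ∈ P.support := by
    intro x y P
    refine ⟨(P.map e.symm.toHom).copy (e.symm_apply_apply x) (e.symm_apply_apply y), ?_⟩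
    intro z hz
    rw [SimpleGraph.Walk.support_copy, SimpleGraph.Walk.support_map, List.mem_map] at hz
    obtain ⟨w, hw, rfl⟩ := hz
    convert hw
    exact e.apply_symm_apply w
  obtain ⟨P', hP'⟩ := key P
  obtain ⟨Q', hQ'⟩ := key Q
  obtain ⟨u, hu, v, hv, huv⟩ := h hs ht hs' ht' P' Q' (fun h => hP (hP' _ h))
    (fun h => hQ (hQ' _ h))
  refine ⟨e u, hP' u hu, e v, hQ' v hv, ?_⟩
  have hne : G.edist u v ≠ ⊤ := fun h => by simp [h] at huv
  obtain ⟨w, hw⟩ := SimpleGraph.exists_walk_of_edist_ne_top hne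
  calc G'.edist (e u) (e v) ≤ (w.map e.toHom).length := SimpleGraph.edist_le _
    _ = G.edist u v := by rw [SimpleGraph.Walk.length_map, hw]
    _ ≤ 2 := huv

theorem edist_le_edist_of_forall_adj {V W : Type*} {H : SimpleGraph W} {G : SimpleGraph V}
    {f : W → V} (hf : ∀ x y, H.Adj x y → f x = f y ∨ G.Adj (f x) (f y)) (x y : W) :
    G.edist (f x) (f y) ≤ H.edist x y := by
  refine le_iInf fun w => ?_
  induction w with
  | nil => simp
  | @cons x z y h w ih =>
    refine (SimpleGraph.edist_triangle (v := f z)).trans ?_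
    rw [SimpleGraph.Walk.length_cons, Nat.cast_add, add_comm, Nat.cast_one]
    exact add_le_add ih (SimpleGraph.edist_le_one_iff_adj_or_eq.2 (hf _ _ h).symm)

/-! ### From walks in a glued graph to flows in the quotient. -/

section Glue

variable {ℓ m k : ℕ} {W : Type u} {H : SimpleGraph W} {r : W} {S T : Set W}
  {σ : Fin (numGaps k) → (S ≃ Fin m)} {τ : Fin (numGaps k) → (T ≃ Fin m)}

/-- The tree vertices in `A`, given by level and position. -/
def TreeIn (A : Set (GlueVertex ℓ m k r S T)) (d p : ℕ) : Prop :=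
  ∃ x : TreeVertex k, x.level = d ∧ x.pos = p ∧ GlueVertex.tree x ∈ A

variable (H σ τ) in
/-- The vertex `x` of the `i`-th copy is joined to the `S`-side of that copy inside `A`. -/
def LinkedLeft (A : Set (GlueVertex ℓ m k r S T)) (i : Fin (numGaps k)) (x : W) : Prop :=
  ∃ s ∈ S, ∃ w : H.Walk s x, ∀ y ∈ w.support, copyVertex ℓ m k i (σ i) (τ i) y ∈ A

variable (H σ τ) in
/-- The copies that are crossed from the `S`-side to the `T`-side inside `A`. -/
def Crosses (A : Set (GlueVertex ℓ m k r S T)) (j : ℕ) : Prop :=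
  ∃ h : j < numGaps k, ∃ t ∈ T, LinkedLeft H σ τ A ⟨j, h⟩ t

variable (H σ τ) in
open Classical in
/-- The projection of the vertices of `A` to the quotient; an inner vertex of a copy is sent to
the anchor on the side to which it is joined inside `A`. -/
noncomputable def proj (A : Set (GlueVertex ℓ m k r S T)) : GlueVertex ℓ m k r S T → ℕ × ℕ ⊕ ℕ
  | .tree x => .inl (x.level, x.pos)
  | .anchor i _ => .inr i
  | .inner i x _ _ _ => .inr (if LinkedLeft H σ τ A i x then i else i + 1)
  | .spine i _ _ => .inr i

variable {A : Set (GlueVertex ℓ m k r S T)}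

theorem copyVertex_root (i : Fin (numGaps k)) :
    (copyVertex ℓ m k i (σ i) (τ i) r : GlueVertex ℓ m k r S T) = .tree (TreeVertex.root k) := by
  simp [copyVertex]

theorem LinkedLeft.of_adj {i : Fin (numGaps k)} {x y : W} (h : LinkedLeft H σ τ A i x)
    (hxy : H.Adj x y) (hy : copyVertex ℓ m k i (σ i) (τ i) y ∈ A) : LinkedLeft H σ τ A i y := by
  obtain ⟨s, hs, w, hw⟩ := h
  refine ⟨s, hs, w.concat hxy, fun z hz => ?_⟩
  rw [SimpleGraph.Walk.support_concat, List.mem_append,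
    List.mem_singleton] at hz
  rcases hz with hz | rfl
  · exact hw z hz
  · exact hy

theorem proj_copyVertex_of_linkedLeft {i : Fin (numGaps k)} {x : W} (hx : x ≠ r)
    (h : LinkedLeft H σ τ A i x) :
    proj H σ τ A (copyVertex ℓ m k i (σ i) (τ i) x) = .inr i.val ∨
      proj H σ τ A (copyVertex ℓ m k i (σ i) (τ i) x) = .inr (i.val + 1) ∧
        Crosses H σ τ A i := by
  rw [copyVertex, dif_neg hx]
  split_ifs with hS hT
  · exact .inl rfl
  · exact .inr ⟨rfl, i.2, x, hT, h⟩
  · simp [proj, h]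

theorem proj_copyVertex_of_not_linkedLeft {i : Fin (numGaps k)} {x : W} (hx : x ≠ r)
    (hA : copyVertex ℓ m k i (σ i) (τ i) x ∈ A) (h : ¬ LinkedLeft H σ τ A i x) :
    proj H σ τ A (copyVertex ℓ m k i (σ i) (τ i) x) = .inr (i.val + 1) := by
  have hS : x ∉ S := fun hS => h ⟨x, hS, .nil, by simpa using hA⟩
  rw [copyVertex, dif_neg hx, dif_neg hS]
  split_ifs with hT
  · rfl
  · simp [proj, h]

theorem glueGraph_adj {u v : GlueVertex ℓ m k r S T} (h : (glueGraph ℓ m k H σ τ).Adj u v) :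
    (∃ x y, (binaryTree k).Adj x y ∧ .tree x = u ∧ .tree y = v) ∨
    (∃ i x y, H.Adj x y ∧ copyVertex ℓ m k i (σ i) (τ i) x = u ∧
      copyVertex ℓ m k i (σ i) (τ i) y = v) ∨
    ∃ i a x y, (SimpleGraph.pathGraph (2 * ℓ + 2)).Adj x y ∧ spineVertex ℓ m k r S T i a x = u ∧
      spineVertex ℓ m k r S T i a y = v := by
  simp only [glueGraph, SimpleGraph.sup_adj, SimpleGraph.iSup_adj, SimpleGraph.map_adj'] at h
  rcases h with (h | ⟨i, h⟩) | ⟨i, a, h⟩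
  · exact .inl h.2
  · exact .inr (.inl ⟨i, h.2⟩)
  · exact .inr (.inr ⟨i, a, h.2⟩)

theorem proj_spineVertex (i : Fin (numGaps k + 1)) (a : Fin m) (q : Fin (2 * ℓ + 2)) :
    (spineVertex ℓ m k r S T i a q = .tree (attachLeaf k i) ∧
      proj H σ τ A (spineVertex ℓ m k r S T i a q) = .inl (k, attachPos k i)) ∨
    proj H σ τ A (spineVertex ℓ m k r S T i a q) = .inr i.val := by
  unfold spineVertex
  split_ifs
  · exact .inl ⟨rfl, rfl⟩
  · exact .inr rfl
  · exact .inr rfl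

/-- Inside a copy, adjacent vertices of `A` are both linked to the left or both not. Unlinked ones
all project to the right anchor, so the projection moves only when a linked vertex lies in `T`,
which is a crossing. -/
theorem proj_adj (hA : .tree (TreeVertex.root k) ∉ A) {u v : GlueVertex ℓ m k r S T}
    (h : (glueGraph ℓ m k H σ τ).Adj u v) (hu : u ∈ A) (hv : v ∈ A) :
    proj H σ τ A u = proj H σ τ A v ∨ ∃ e, Supports k (TreeIn A) (Crosses H σ τ A) e ∧
      ∀ f, f (proj H σ τ A u) + f (proj H σ τ A v) = coboundary k f e := by
  rcases glueGraph_adj h with ⟨x, y, hxy, rfl, rfl⟩ | ⟨i, x, y, hxy, rfl, rfl⟩ |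
    ⟨i, a, x, y, -, rfl, rfl⟩
  · right
    have key : ∀ x y : TreeVertex k, x.IsParent y → .tree x ∈ A → .tree y ∈ A →
        ∃ e, Supports k (TreeIn A) (Crosses H σ τ A) e ∧
          ∀ f, f (proj H σ τ A (.tree y)) + f (proj H σ τ A (.tree x)) = coboundary k f e := by
      rintro x y ⟨h1, h2⟩ hx hy
      refine ⟨.top x.level y.pos, ⟨h1 ▸ y.level_le, ⟨y, h1, rfl, hy⟩, ⟨x, rfl, h2.symm, hx⟩⟩, ?_⟩
      intro f
      simp only [proj, coboundary, h1, h2]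
    rcases hxy with hxy | hxy
    · obtain ⟨e, he, hf⟩ := key x y hxy hu hv
      exact ⟨e, he, fun f => by rw [add_comm, hf]⟩
    · exact key y x hxy hv hu
  · have hx : x ≠ r := by rintro rfl; exact hA (copyVertex_root (σ := σ) (τ := τ) i ▸ hu)
    have hy : y ≠ r := by rintro rfl; exact hA (copyVertex_root (σ := σ) (τ := τ) i ▸ hv)
    by_cases hl : LinkedLeft H σ τ A i x
    · have hl' := hl.of_adj hxy hv
      rcases proj_copyVertex_of_linkedLeft hx hl with h1 | ⟨h1, hc⟩ <;>
        rcases proj_copyVertex_of_linkedLeft hy hl' with h2 | ⟨h2, hc'⟩ <;> rw [h1, h2]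
      · exact .inl rfl
      · exact .inr ⟨.line i, ⟨i.2, hc'⟩, fun f => rfl⟩
      · exact .inr ⟨.line i, ⟨i.2, hc⟩, fun f => add_comm _ _⟩
      · exact .inl rfl
    · have hl' : ¬ LinkedLeft H σ τ A i y := fun hl' => hl (hl'.of_adj hxy.symm hu)
      left
      rw [proj_copyVertex_of_not_linkedLeft hx hu hl, proj_copyVertex_of_not_linkedLeft hy hv hl']
  · rcases proj_spineVertex (H := H) (σ := σ) (τ := τ) (A := A) i a x with ⟨h1, h2⟩ | h2 <;>
      rcases proj_spineVertex (H := H) (σ := σ) (τ := τ) (A := A) i a y with ⟨h3, h4⟩ | h4 <;>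
      rw [h2, h4]
    · exact .inl rfl
    · exact .inr ⟨.spine i, ⟨attachLeaf k i, rfl, rfl, h1 ▸ hu⟩, fun f => add_comm _ _⟩
    · exact .inr ⟨.spine i, ⟨attachLeaf k i, rfl, rfl, h3 ▸ hv⟩, fun f => rfl⟩
    · exact .inl rfl

theorem exists_flow_of_walk (hA : .tree (TreeVertex.root k) ∉ A) {u v : GlueVertex ℓ m k r S T}
    (P : (glueGraph ℓ m k H σ τ).Walk u v) (hP : ∀ x ∈ P.support, x ∈ A) :
    ∃ L : List QuotientEdge, (∀ e ∈ L, Supports k (TreeIn A) (Crosses H σ τ A) e) ∧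
      ∀ f, f (proj H σ τ A u) + f (proj H σ τ A v) = (L.map (coboundary k f)).sum := by
  induction P with
  | nil => exact ⟨[], by simp, fun f => by simp [CharTwo.add_self_eq_zero]⟩
  | @cons u v w h P ih =>
    simp only [SimpleGraph.Walk.support_cons, List.mem_cons, forall_eq_or_imp] at hP
    obtain ⟨L, hL, hf⟩ := ih hP.2
    rcases proj_adj hA h hP.1 (hP.2 _ P.start_mem_support) with heq | ⟨e, he, hf'⟩
    · exact ⟨L, hL, fun f => by rw [heq, hf]⟩
    · refine ⟨e :: L, by simpa using ⟨he, hL⟩, fun f => ?_⟩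
      -- The intermediate vertex contributes twice, hence cancels.
      rw [List.map_cons, List.sum_cons, ← hf, ← hf']
      linear_combination - CharTwo.add_self_eq_zero (f (proj H σ τ A v))

theorem proj_of_mem_glueS {s : GlueVertex ℓ m k r S T} (hs : s ∈ glueS ℓ m k r S T) :
    proj H σ τ A s = .inr 0 ∨ proj H σ τ A s = .inl (k, 0) := by
  rcases hs with rfl | ⟨a, rfl⟩
  · exact .inr rfl
  · exact .inl rfl

theorem proj_of_mem_glueT {t : GlueVertex ℓ m k r S T} (ht : t ∈ glueT ℓ m k r S T) :
    proj H σ τ A t = .inr (numGaps k) ∨ proj H σ τ A t = .inl (k, 2 ^ k - 1) := by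
  rcases ht with rfl | ⟨a, rfl⟩
  · exact .inr rfl
  · exact .inl rfl

/-! ### Distances in the glued graph and the induction step. -/

theorem edist_copyVertex_le (i : Fin (numGaps k)) (x y : W) :
    (glueGraph (r := r) ℓ m k H σ τ).edist (copyVertex ℓ m k i (σ i) (τ i) x)
      (copyVertex ℓ m k i (σ i) (τ i) y) ≤ H.edist x y := by
  refine edist_le_edist_of_forall_adj (f := copyVertex ℓ m k i (σ i) (τ i)) (fun x y h => ?_) x y
  refine or_iff_not_imp_left.2 fun hne => ?_
  refine Or.inl (Or.inr ?_)
  exact SimpleGraph.iSup_adj.2 ⟨i, hne, x, y, h, rfl, rfl⟩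

theorem edist_tree_le_one {x y : TreeVertex k} (h : x.IsParent y) :
    (glueGraph (r := r) ℓ m k H σ τ).edist (.tree x) (.tree y) ≤ 1 := by
  refine SimpleGraph.edist_le_one_iff_adj_or_eq.2 (or_iff_not_imp_right.2 fun hne => ?_)
  exact Or.inl (Or.inl ⟨hne, x, y, Or.inl h, rfl, rfl⟩)

theorem edist_siblings_le_two {x y : TreeVertex k} {d p : ℕ} (hx : x.level = d + 1)
    (hx' : x.pos = 2 * p) (hy : y.level = d + 1) (hy' : y.pos = 2 * p + 1) :
    (glueGraph (r := r) ℓ m k H σ τ).edist (.tree x) (.tree y) ≤ 2 := by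
  have hp : p < 2 ^ d := by
    have := x.pos_lt
    rw [hx, hx', pow_succ] at this
    omega
  let z : TreeVertex k := ⟨d, p, by have := x.level_le; omega, hp⟩
  have h1 : z.IsParent x := ⟨hx, by simp [hx', z]⟩
  have h2 : z.IsParent y := ⟨hy, by simp only [hy', z]; omega⟩
  calc _ ≤ _ := SimpleGraph.edist_triangle (v := .tree z)
    _ ≤ 1 + 1 := add_le_add (SimpleGraph.edist_comm.trans_le (edist_tree_le_one h1))
      (edist_tree_le_one h2)
    _ = 2 := one_add_one_eq_two

theorem WalksClose.glue (hH : WalksClose H r S T) (hk : 1 ≤ k) :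
    WalksClose (glueGraph ℓ m k H σ τ) (.tree (TreeVertex.root k)) (glueS ℓ m k r S T)
      (glueT ℓ m k r S T) := by
  intro s t s' t' hs ht hs' ht' P Q hP hQ
  by_contra! hfar
  let A : Bool → Set (GlueVertex ℓ m k r S T) := fun β =>
    if β then {x | x ∈ P.support} else {x | x ∈ Q.support}
  have hA : ∀ β, .tree (TreeVertex.root k) ∉ A β := by
    rintro (_ | _)
    exacts [hQ, hP]
  have hAfar : ∀ β, ∀ x ∈ A β, ∀ y ∈ A (!β),
      ¬ (glueGraph ℓ m k H σ τ).edist x y ≤ 2 := by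
    rintro (_ | _) x hx y hy
    · rw [SimpleGraph.edist_comm]
      exact (hfar y hy x hx).not_ge
    · exact (hfar x hx y hy).not_ge
  have hflow : ∀ β, ∃ L : List QuotientEdge,
      (∀ e ∈ L, Supports k (TreeIn (A β)) (Crosses H σ τ (A β)) e) ∧
      ∃ s t : ℕ × ℕ ⊕ ℕ, (s = .inr 0 ∨ s = .inl (k, 0)) ∧
        (t = .inr (numGaps k) ∨ t = .inl (k, 2 ^ k - 1)) ∧
        ∀ f, f s + f t = (L.map (coboundary k f)).sum := by
    rintro (_ | _)
    · obtain ⟨L, hL, hf⟩ := exists_flow_of_walk (hA false) Q fun x hx => hx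
      exact ⟨L, hL, _, _, proj_of_mem_glueS hs', proj_of_mem_glueT ht', hf⟩
    · obtain ⟨L, hL, hf⟩ := exists_flow_of_walk (hA true) P fun x hx => hx
      exact ⟨L, hL, _, _, proj_of_mem_glueS hs, proj_of_mem_glueT ht, hf⟩
  choose L hL hflow using hflow
  refine FarFlows.not_far ⟨fun β => TreeIn (A β), fun β => Crosses H σ τ (A β), L, hL, hflow,
    ?_, ?_, ?_, ?_⟩ hk
  -- If both cross a copy, the induction hypothesis applies to the crossing walks. These stay in `A`
  -- but need not be segments of `P` or `Q`, or paths.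
  · rintro β i ⟨hi, t, ht, s, hs, w, hw⟩ ⟨_, t', ht', s', hs', w', hw'⟩
    obtain ⟨x, hx, y, hy, hxy⟩ := hH hs ht hs' ht' w w'
      (fun h => hA β (copyVertex_root (σ := σ) (τ := τ) ⟨i, hi⟩ ▸ hw _ h))
      (fun h => hA (!β) (copyVertex_root (σ := σ) (τ := τ) ⟨i, hi⟩ ▸ hw' _ h))
    exact hAfar β _ (hw x hx) _ (hw' y hy) ((edist_copyVertex_le _ x y).trans hxy)
  · rintro β d p ⟨x, h1, h2, hx⟩ ⟨y, h3, h4, hy⟩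
    obtain rfl : x = y := TreeVertex.ext (h1.trans h3.symm) (h2.trans h4.symm)
    exact hAfar β _ hx _ hy (by simp)
  · rintro β d p ⟨x, h1, h2, hx⟩ ⟨y, h3, h4, hy⟩
    exact hAfar β _ hx _ hy (edist_siblings_le_two h1 h2 h3 h4)
  · rintro β ⟨x, h1, h2, hx⟩
    obtain rfl : x = TreeVertex.root k := TreeVertex.ext h1 h2
    exact hA β hx

end Glue

/-! ### Induction on blocks and the theorem. -/

theorem IsBlock.walksClose {ℓ m : ℕ} (hℓ : 1 ≤ ℓ) {V : Type u} {G : SimpleGraph V} {r : V}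
    {S T : Set V} (h : IsBlock ℓ m G r S T) : WalksClose G r S T := by
  induction h with
  | one e hr hS hT =>
    subst hS
    rintro s t s' t' rfl - rfl - P Q - -
    exact ⟨_, P.start_mem_support, _, Q.start_mem_support, by simp⟩
  | step hk hH σ τ e hr hS hT ih =>
    subst hr hS hT
    exact (ih.glue (by omega)).of_iso e

end CoarseMenger

theorem theorem2p1 (ℓ m : ℕ) (hℓ : 1 ≤ ℓ)
    {V : Type*} (G : SimpleGraph V) (r₀ : V) (S T : Set V)
    (hG : CoarseMenger.IsBlock ℓ (m + 1) G r₀ S T)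
    {s t s' t' : V} (hs : s ∈ S) (ht : t ∈ T) (hs' : s' ∈ S) (ht' : t' ∈ T)
    (P : G.Walk s t) (hP : P.IsPath) (Q : G.Walk s' t') (hQ : Q.IsPath) :
    (r₀ ∈ P.support ∨ r₀ ∈ Q.support) ∨
      CoarseMenger.setDist G {v | v ∈ P.support} {v | v ∈ Q.support} ≤ 2 := by
  by_cases h : r₀ ∈ P.support ∨ r₀ ∈ Q.support
  · exact .inl h
  · rw [not_or] at h
    obtain ⟨u, hu, v, hv, huv⟩ := hG.walksClose hℓ hs ht hs' ht' P Q h.1 h.2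
    exact .inr ((iInf₂_le_of_le u hu (iInf₂_le v hv)).trans huv)
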